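/- A convex body in the $n$-dimensional Euclidean space $\mathbb{E}^n$ is a compact convex set with non-empty interior. For $A,B\subset\mathbb{E}^n$ let $C(A,B)$ be the smallest number of translates of $B$ required to cover $A$ (with $C(A,B)=\infty$ if no finite number of translates suffices), and let $$H_n=\sup\{\,C(K,\operatorname{int}(K)) : K\subset\mathbb{E}^n \text{ a convex body}\,\},$$ that is, $H_n$ is the smallest number $N$ such that every convex body $K\subset\mathbb{E}^n$ can be covered by at most $N$ translates of its interior. Theorem. $H_4\le 96$, $H_5\le 1091$ and $H_6\le 15373$. -/

import Mathlib

open scoped Pointwise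

/-- `translativeCoveringNumber A B` is the smallest number of translates of `B` required to cover
`A`: the least cardinality of a set `T` of translation vectors such that the translates `t +ᵥ B`, `t ∈ T`, cover `A`.
It is `⊤` if no finite number of translates of `B` covers `A`. -/
noncomputable def translativeCoveringNumber {n : ℕ} (A B : Set (EuclideanSpace ℝ (Fin n))) : ℕ∞ :=
  ⨅ (T : Set (EuclideanSpace ℝ (Fin n))) (_ : A ⊆ ⋃ t ∈ T, (t +ᵥ B)), T.encard

/-- The Hadwiger covering number `H_n`: the least number `N` such that every convex body `K`
(a compact convex set with non-empty interior) in `n`-dimensional Euclidean space can be covered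
by at most `N` translates of its interior, i.e. the supremum over all `K` of the covering number
of `K` by translates of `interior K`. Mathlib's `ConvexBody` does not include the condition on the
interior, so it is added here. -/
noncomputable def hadwigerCoveringNumber (n : ℕ) : ℕ∞ :=
  ⨆ (K : ConvexBody (EuclideanSpace ℝ (Fin n)))
    (_ : (interior (K : Set (EuclideanSpace ℝ (Fin n)))).Nonempty),
    translativeCoveringNumber (K : Set (EuclideanSpace ℝ (Fin n)))
      (interior (K : Set (EuclideanSpace ℝ (Fin n))))

/-! It is enough to illuminate `K` by few directions. A parallelepiped of maximal volume spanned by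
vectors of `K - K` gives coordinates in which `K` lies in the unit cube and contains a unit segment
in every coordinate direction. Averaging these segments puts a translate of every box with side sum
below `1` into the interior (`InUnitCubePosition.exists_box_subset_interior`).

Now project a boundary point `x` of `K` from an interior point to a facet of the cube, and then,
within that facet, from a point `g` of `K` to the codimension two skeleton. Convexity pulls a
direction that works at the final point back to `x` (`exists_illuminating_of_skeleton`); only `x =
g` is lost. Hence a covering of the skeleton by `N` such boxes gives `N + 2n` directions, and `N`
suffice if every facet contains two points of `K`, since then `g ≠ x` can be arranged.

The coverings come from layerings (`IsLayering.skeletonCoverable`): 1072 boxes for `n = 5` and 15292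
for `n = 6`. For `n = 4`, 96 boxes are used if all facets have two points of `K`. Otherwise the cube
is replaced by a slightly shorter box, whose skeleton needs only 88 boxes, and 88 + 8 = 96. -/

/-! ### Illumination and covering by translates of the interior. -/

/-- A set of directions `U` illuminates `K` if every point of `K` can be moved into the interior
of `K` along one of the directions. -/
def Illuminates {E : Type*} [TopologicalSpace E] [AddCommGroup E] [Module ℝ E]
    (U K : Set E) : Prop :=
  ∀ x ∈ K, ∃ u ∈ U, ∃ μ : ℝ, 0 < μ ∧ x + μ • u ∈ interior K

theorem Convex.add_smul_mem_interior_of_le {E : Type*} [NormedAddCommGroup E] [NormedSpace ℝ E]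
    {K : Set E} (hK : Convex ℝ K) {x u : E} (hx : x ∈ K) {μ ν : ℝ} (hν : 0 < ν) (hνμ : ν ≤ μ)
    (h : x + μ • u ∈ interior K) : x + ν • u ∈ interior K := by
  have hμ : 0 < μ := hν.trans_le hνμ
  have := hK.add_smul_mem_interior hx (y := μ • u) h (t := ν / μ)
    ⟨by positivity, (div_le_one hμ).2 hνμ⟩
  rwa [smul_smul, div_mul_cancel₀ _ hμ.ne'] at this

/-- A direction that works at a point with some step works there with every smaller positive step.
By compactness a single step length then serves all of `K`, so each direction contributes one
translate. -/
theorem translativeCoveringNumber_le_card {n : ℕ} {K : Set (EuclideanSpace ℝ (Fin n))}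
    (hc : IsCompact K) (hK : Convex ℝ K) (U : Finset (EuclideanSpace ℝ (Fin n)))
    (hU : Illuminates (U : Set (EuclideanSpace ℝ (Fin n))) K) :
    translativeCoveringNumber K (interior K) ≤ U.card := by
  classical
  let V : ℕ → Set (EuclideanSpace ℝ (Fin n)) := fun m =>
    ⋃ u ∈ U, (fun x => x + (1 / ((m : ℝ) + 1)) • u) ⁻¹' interior K
  have hVo : ∀ m, IsOpen (V m) := fun m =>
    isOpen_biUnion fun u _ => isOpen_interior.preimage (by fun_prop)
  have hcov : K ⊆ ⋃ m, V m := by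
    intro x hx
    obtain ⟨u, hu, μ, hμ, h⟩ := hU x hx
    obtain ⟨m, hm⟩ := exists_nat_one_div_lt hμ
    refine Set.mem_iUnion.2 ⟨m, Set.mem_iUnion₂.2 ⟨u, hu, ?_⟩⟩
    exact hK.add_smul_mem_interior_of_le hx (by positivity) hm.le h
  obtain ⟨t, ht⟩ := hc.elim_finite_subcover V hVo hcov
  let M := t.sup id
  let T : Finset (EuclideanSpace ℝ (Fin n)) := U.image fun u => -((1 / ((M : ℝ) + 1)) • u)
  have hT : K ⊆ ⋃ t ∈ (T : Set (EuclideanSpace ℝ (Fin n))), (t +ᵥ interior K) := by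
    intro x hx
    obtain ⟨m, hm, hxm⟩ := Set.mem_iUnion₂.1 (ht hx)
    obtain ⟨u, hu, h⟩ := Set.mem_iUnion₂.1 hxm
    have hmM : m ≤ M := Finset.le_sup (f := id) hm
    have h' : x + (1 / ((M : ℝ) + 1)) • u ∈ interior K := by
      refine hK.add_smul_mem_interior_of_le hx (by positivity) ?_ h
      have : (m : ℝ) ≤ M := by exact_mod_cast hmM
      gcongr
    refine Set.mem_iUnion₂.2 ⟨_, Finset.mem_coe.2 (Finset.mem_image_of_mem _ hu), ?_⟩
    refine Set.mem_vadd_set.2 ⟨_, h', ?_⟩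
    simp
  calc translativeCoveringNumber K (interior K) ≤ (T : Set (EuclideanSpace ℝ (Fin n))).encard :=
        iInf₂_le (f := fun (T : Set (EuclideanSpace ℝ (Fin n)))
          (_ : K ⊆ ⋃ t ∈ T, (t +ᵥ interior K)) => T.encard) _ hT
    _ = T.card := Set.encard_coe_eq_coe_finsetCard _
    _ ≤ U.card := by exact_mod_cast Finset.card_image_le

theorem Illuminates.of_affine_image {E F : Type*} [NormedAddCommGroup E] [NormedSpace ℝ E]
    [NormedAddCommGroup F] [NormedSpace ℝ F] (A : E ≃L[ℝ] F) (c : F) {K : Set E} {U : Set F}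
    (h : Illuminates U ((fun x => A x + c) '' K)) : Illuminates (A.symm '' U) K := by
  intro x hx
  obtain ⟨u, hu, μ, hμ, h⟩ := h _ (Set.mem_image_of_mem _ hx)
  refine ⟨A.symm u, Set.mem_image_of_mem _ hu, μ, hμ, ?_⟩
  have e : (fun x => A x + c) = (A.toHomeomorph.trans (Homeomorph.addRight c)) := by
    ext; simp
  rw [e, ← Homeomorph.image_interior] at h
  obtain ⟨y, hy, hyx⟩ := h
  have : y = x + μ • A.symm u := by
    apply A.injective
    have : A y + c = A x + c + μ • u := by simpa using hyx
    rw [map_add, map_smul, A.apply_symm_apply]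
    have h2 : A y + c = (A x + μ • u) + c := by rw [this]; abel
    exact add_right_cancel h2
  exact this ▸ hy

/-! ### Normalising the body by a maximal determinant. -/

/-- The body `K` lies in the unit cube and contains a unit segment in each coordinate direction. -/
structure InUnitCubePosition {ι : Type*} [Fintype ι] [DecidableEq ι] (K : Set (ι → ℝ)) : Prop where
  isCompact : IsCompact K
  convex : Convex ℝ K
  interior_nonempty : (interior K).Nonempty
  subset : ∀ x ∈ K, ∀ i, 0 ≤ x i ∧ x i ≤ 1
  exists_segment : ∀ i, ∃ p ∈ K, p + Pi.single i 1 ∈ K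

theorem exists_maximal_det {n : ℕ} {D : Set (Fin n → ℝ)} (hc : IsCompact D)
    (h0 : (0 : Fin n → ℝ) ∈ interior D) :
    ∃ M : Matrix (Fin n) (Fin n) ℝ, (∀ i, M i ∈ D) ∧ M.det ≠ 0 ∧
      ∀ N : Matrix (Fin n) (Fin n) ℝ, (∀ i, N i ∈ D) → |N.det| ≤ |M.det| := by
  let S : Set (Fin n → Fin n → ℝ) := Set.univ.pi fun _ => D
  have hS : IsCompact S := isCompact_univ_pi fun _ => hc
  have hne : S.Nonempty := ⟨fun _ => 0, fun _ _ => interior_subset h0⟩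
  have hcont : Continuous fun M : Fin n → Fin n → ℝ => |(Matrix.of M).det| :=
    (Continuous.matrix_det (A := fun M : Fin n → Fin n → ℝ => Matrix.of M) continuous_id).abs
  obtain ⟨M, hM, hmax⟩ := hS.exists_isMaxOn hne hcont.continuousOn
  have hpos : 0 < |(Matrix.of M).det| := by
    have hev : ∀ᶠ t : ℝ in nhds 0, ∀ i : Fin n, t • (Pi.single i 1 : Fin n → ℝ) ∈ interior D := by
      refine Filter.eventually_all.2 fun i => ?_
      have hct : Continuous fun t : ℝ => t • (Pi.single i 1 : Fin n → ℝ) := by fun_prop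
      exact hct.continuousAt.eventually_mem (isOpen_interior.mem_nhds (by simpa using h0))
    obtain ⟨t, ht, ht0⟩ := ((hev.filter_mono nhdsWithin_le_nhds).and
      (self_mem_nhdsWithin : Set.Ioi (0 : ℝ) ∈ nhdsWithin 0 (Set.Ioi 0))).exists
    have h1 := hmax (show (fun i => t • (Pi.single i 1 : Fin n → ℝ)) ∈ S from
      fun i _ => interior_subset (ht i))
    refine lt_of_lt_of_le ?_ h1
    have e : Matrix.of (fun i => t • (Pi.single i 1 : Fin n → ℝ)) =
        t • (1 : Matrix (Fin n) (Fin n) ℝ) := by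
      ext i j
      simp [Matrix.one_apply, Pi.single_apply, eq_comm]
    simp only [e, Matrix.det_smul, Matrix.det_one]
    have : (0 : ℝ) < t := ht0
    positivity
  exact ⟨Matrix.of M, fun i => hM i trivial, abs_pos.1 hpos, fun N hN =>
    hmax (show (fun i => N i) ∈ S from fun i _ => hN i)⟩

/-- The vectors of `K - K` with maximal determinant become the standard basis. By Cramer's rule a
coordinate of a vector of `K - K` is a quotient of two such determinants, hence at most `1`. -/
theorem exists_inUnitCubePosition {E : Type*} [NormedAddCommGroup E] [NormedSpace ℝ E] {n : ℕ}
    (φ : E ≃L[ℝ] (Fin n → ℝ)) {K : Set E} (hc : IsCompact K) (hK : Convex ℝ K)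
    (hi : (interior K).Nonempty) :
    ∃ (A : E ≃L[ℝ] (Fin n → ℝ)) (c : Fin n → ℝ),
      InUnitCubePosition ((fun x => A x + c) '' K) := by
  let K₁ : Set (Fin n → ℝ) := φ '' K
  have hc₁ : IsCompact K₁ := hc.image φ.continuous
  have hi₁ : (interior K₁).Nonempty := by
    obtain ⟨x, hx⟩ := hi
    refine ⟨φ x, ?_⟩
    have := φ.toHomeomorph.image_interior K
    exact this ▸ (⟨x, hx, rfl⟩ : φ x ∈ φ.toHomeomorph '' interior K)
  let D : Set (Fin n → ℝ) := K₁ - K₁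
  have hD0 : (0 : Fin n → ℝ) ∈ interior D := by
    obtain ⟨x, hx⟩ := hi₁
    refine interior_mono (Set.sub_subset_sub_right (interior_subset (s := K₁))) ?_
    have : IsOpen (interior K₁ - K₁) := isOpen_interior.sub_right
    rw [this.interior_eq]
    exact ⟨x, hx, x, interior_subset hx, sub_self x⟩
  obtain ⟨M, hM, hdet, hmax⟩ := exists_maximal_det (D := D) (by simpa only [D, sub_eq_add_neg] using hc₁.add hc₁.neg) hD0
  have hu : IsUnit M.transpose.det := by rw [Matrix.det_transpose]; exact hdet.isUnit
  let B : (Fin n → ℝ) ≃L[ℝ] (Fin n → ℝ) :=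
    (Matrix.toLinearEquiv' M.transpose (Matrix.invertibleOfIsUnitDet _ hu)).toContinuousLinearEquiv
  have hB : ∀ y, B y = M.transpose.mulVec y := fun y => rfl
  have hBs : ∀ x, B.symm x = M.det⁻¹ • Matrix.cramer M.transpose x := by
    intro x
    rw [ContinuousLinearEquiv.symm_apply_eq, hB, Matrix.mulVec_smul, Matrix.mulVec_cramer,
      Matrix.det_transpose, smul_smul, inv_mul_cancel₀ hdet, one_smul]
  have hBe : ∀ i, B.symm (M i) = Pi.single i 1 := by
    intro i
    rw [ContinuousLinearEquiv.symm_apply_eq, hB]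
    ext j
    simp
  have hbound : ∀ x ∈ D, ∀ i, B.symm x i ≤ 1 := by
    intro x hx i
    rw [hBs, Pi.smul_apply, Matrix.cramer_transpose_apply, smul_eq_mul]
    refine (le_abs_self _).trans ?_
    rw [abs_mul, abs_inv, inv_mul_le_iff₀ (abs_pos.2 hdet), mul_one]
    refine hmax _ fun j => ?_
    rcases eq_or_ne j i with rfl | h
    · simpa using hx
    · simpa [h] using hM j
  choose q hq p hp hqp using hM
  let c : Fin n → ℝ := fun i => -(B.symm (p i) i)
  refine ⟨φ.trans B.symm, c, ?_⟩
  have himg : (fun x => (φ.trans B.symm) x + c) '' K = (fun x => B.symm x + c) '' K₁ := by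
    rw [Set.image_image]; rfl
  have hqi : ∀ i, B.symm (q i) = B.symm (p i) + Pi.single i 1 := by
    intro i
    have h : q i - p i = M i := hqp i
    rw [← hBe, ← map_add, ← h]
    congr 1; abel
  rw [himg]
  refine ⟨hc₁.image (by fun_prop), ?_, ?_, ?_, ?_⟩
  · have h1 : Convex ℝ K₁ := hK.linear_image φ.toLinearEquiv.toLinearMap
    have h2 := (h1.linear_image B.symm.toLinearEquiv.toLinearMap).translate c
    rw [Set.image_image] at h2
    simp only [add_comm _ c]
    exact h2
  · obtain ⟨x, hx⟩ := hi₁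
    have e : (fun x => B.symm x + c) = (B.symm.toHomeomorph.trans (Homeomorph.addRight c)) := by
      ext; simp
    rw [e, ← Homeomorph.image_interior]
    exact ⟨_, x, hx, rfl⟩
  -- The endpoints `p i` and `q i` differ by `1` in coordinate `i`; bounding `x - p i` and `q i - x`
  -- confines `x` between them.
  · rintro _ ⟨x, hx, rfl⟩ i
    have h1 := hbound _ ⟨x, hx, p i, hp i, rfl⟩ i
    have h2 := hbound _ ⟨q i, hq i, x, hx, rfl⟩ i
    simp only [map_sub, hqi, Pi.sub_apply, Pi.add_apply, Pi.single_eq_same] at h1 h2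
    simp only [Pi.add_apply, c]
    constructor <;> linarith
  · intro i
    refine ⟨_, ⟨p i, hp i, rfl⟩, q i, hq i, ?_⟩
    simp only [hqi]
    abel

/-! ### Boxes inside the body and projection to the skeleton. -/

section Boxes

variable {ι : Type*} [Fintype ι]

/-- The body contains in its interior translates of all boxes with side lengths adding up to less
than `1`. -/
theorem InUnitCubePosition.exists_box_subset_interior [DecidableEq ι] {K : Set (ι → ℝ)}
    (hK : InUnitCubePosition K) {s : ι → ℝ} (hs : ∀ i, 0 ≤ s i) (hsum : ∑ i, s i < 1) :
    ∃ w : ι → ℝ, ∀ q : ι → ℝ, (∀ i, 0 ≤ q i ∧ q i ≤ s i) → w + q ∈ interior K := by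
  obtain ⟨o, ho⟩ := hK.interior_nonempty
  choose p hp hp' using hK.exists_segment
  set σ := ∑ i, s i with hσ
  have hσ0 : 0 ≤ σ := Finset.sum_nonneg fun i _ => hs i
  refine ⟨∑ i, s i • p i + (1 - σ) • o, fun q hq => ?_⟩
  -- If `s i = 0`, then `q i = 0` and `q i / s i` is `0` by convention; the point then has weight
  -- zero.
  let x : ι → ι → ℝ := fun i => p i + (q i / s i) • Pi.single i 1
  have hx : ∀ i, x i ∈ K := by
    intro i
    have h0 : 0 ≤ q i / s i := div_nonneg (hq i).1 (hs i)
    have h1 : q i / s i ≤ 1 := div_le_one_of_le₀ (hq i).2 (hs i)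
    exact hK.convex.add_smul_mem (hp i) (hp' i) ⟨h0, h1⟩
  have hsx : ∑ i, s i • x i = ∑ i, s i • p i + q := by
    simp only [x, smul_add, Finset.sum_add_distrib, smul_smul]
    congr 1
    ext j
    rw [Finset.sum_apply, Finset.sum_eq_single j]
    · rcases (hs j).eq_or_lt with h | h
      · have := hq j
        simp [← h]; linarith
      · simp [mul_div_cancel₀ _ h.ne']
    · intro i _ hij
      simp [hij.symm]
    · simp
  have hgoal : ∑ i, s i • p i + (1 - σ) • o + q = (1 - σ) • o + ∑ i, s i • x i := by
    rw [hsx]; abel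
  rw [hgoal]
  rcases hσ0.eq_or_lt with h | h
  · have hz : ∀ i, s i = 0 := fun i =>
      (Finset.sum_eq_zero_iff_of_nonneg fun i _ => hs i).1 h.symm i (Finset.mem_univ i)
    simpa [← h, hz] using ho
  · have hm : (Finset.univ.centerMass s x) ∈ K :=
      hK.convex.centerMass_mem (fun i _ => hs i) h fun i _ => hx i
    have he : ∑ i, s i • x i = σ • Finset.univ.centerMass s x := by
      rw [Finset.centerMass, ← hσ, smul_smul, mul_inv_cancel₀ h.ne', one_smul]
    rw [he]
    exact hK.convex.combo_interior_self_mem_interior ho hm (by linarith) h.le (by ring)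

/-- A ray from a point of a box leaves the box through a facet. -/
theorem exists_exit_of_box {A B g y : ι → ℝ} (hg : ∀ i, A i ≤ g i ∧ g i ≤ B i)
    (hy : ∀ i, A i ≤ y i ∧ y i ≤ B i) (hgy : y ≠ g) :
    ∃ (r : ℝ) (j : ι), 1 ≤ r ∧ y j ≠ g j ∧
      (∀ i, A i ≤ (g + r • (y - g)) i ∧ (g + r • (y - g)) i ≤ B i) ∧
      ((g + r • (y - g)) j = A j ∨ (g + r • (y - g)) j = B j) := by
  -- The parameter at which coordinate `j` reaches its bound; the minimum over the moving
  -- coordinates is the exit time.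
  let ρ : ι → ℝ := fun j =>
    if g j < y j then (B j - g j) / (y j - g j) else (A j - g j) / (y j - g j)
  let S : Finset ι := Finset.univ.filter fun j => y j ≠ g j
  have hS : S.Nonempty := by
    obtain ⟨j, hj⟩ := Function.ne_iff.1 hgy
    exact ⟨j, by simp [S, hj]⟩
  obtain ⟨j, hj, hmin⟩ := S.exists_min_image ρ hS
  have hj' : y j ≠ g j := by simpa [S] using hj
  have hρ1 : 1 ≤ ρ j := by
    simp only [ρ]
    split_ifs with h
    · rw [le_div_iff₀ (by linarith)]; linarith [(hy j).2]
    · have : y j - g j < 0 := sub_neg.2 (lt_of_le_of_ne (not_lt.1 h) hj')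
      rw [le_div_iff_of_neg this]; linarith [(hy j).1]
  refine ⟨ρ j, j, hρ1, hj', fun i => ?_, ?_⟩
  · simp only [Pi.add_apply, Pi.smul_apply, Pi.sub_apply, smul_eq_mul]
    rcases lt_trichotomy (g i) (y i) with h | h | h
    · have h1 := hmin i (by simp [S, h.ne'])
      simp only [ρ, if_pos h] at h1
      have h2 : ρ j * (y i - g i) ≤ B i - g i := by
        rwa [le_div_iff₀ (by linarith)] at h1
      have h3 : 0 ≤ ρ j * (y i - g i) := mul_nonneg (by linarith) (by linarith)
      exact ⟨by linarith [(hg i).1], by linarith⟩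
    · simpa [h] using hy i
    · have h1 := hmin i (by simp [S, h.ne])
      simp only [ρ, if_neg h.le.not_gt] at h1
      have h2 : A i - g i ≤ ρ j * (y i - g i) := by
        rwa [le_div_iff_of_neg (by linarith)] at h1
      have h3 : ρ j * (y i - g i) ≤ 0 :=
        mul_nonpos_of_nonneg_of_nonpos (by linarith) (by linarith)
      exact ⟨by linarith, by linarith [(hg i).2]⟩
  · have hne : y j - g j ≠ 0 := sub_ne_zero.2 hj'
    simp only [Pi.add_apply, Pi.smul_apply, Pi.sub_apply, smul_eq_mul, ρ]
    split_ifs with h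
    · right; rw [div_mul_cancel₀ _ hne]; ring
    · left; rw [div_mul_cancel₀ _ hne]; ring

/-- The union of the faces of codimension two of the box with opposite corners `A` and `B`. -/
def codimTwoSkeleton (A B : ι → ℝ) : Set (ι → ℝ) :=
  {z | (∀ i, A i ≤ z i ∧ z i ≤ B i) ∧
    ∃ i j, i ≠ j ∧ (z i = A i ∨ z i = B i) ∧ (z j = A j ∨ z j = B j)}

/-- If translates of the interior of `K` cover the codimension two skeleton of a box, then the
translation vectors illuminate all points of `K` in the box except for one point in each facet. -/
theorem exists_illuminating_of_skeleton {K U : Set (ι → ℝ)} (hK : Convex ℝ K) {A B o x : ι → ℝ}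
    (ho : o ∈ interior K) (hoAB : ∀ i, A i ≤ o i ∧ o i ≤ B i)
    (hA : ∀ i, ∃ g ∈ K, (∀ i, A i ≤ g i ∧ g i ≤ B i) ∧ g i = A i ∧ g ≠ x)
    (hB : ∀ i, ∃ g ∈ K, (∀ i, A i ≤ g i ∧ g i ≤ B i) ∧ g i = B i ∧ g ≠ x)
    (hU : ∀ z ∈ codimTwoSkeleton A B, ∃ u ∈ U, z + u ∈ interior K)
    (hxAB : ∀ i, A i ≤ x i ∧ x i ≤ B i) (hxK : x ∉ interior K) :
    ∃ u ∈ U, ∃ μ : ℝ, 0 < μ ∧ x + μ • u ∈ interior K := by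
  have hxo : x ≠ o := fun h => hxK (h ▸ ho)
  obtain ⟨t, i, ht, -, hyAB, hyi⟩ := exists_exit_of_box hoAB hxAB hxo
  set y := o + t • (x - o) with hy
  have ht0 : 0 < t := by linarith
  have hxy : x = (1 - t⁻¹) • o + t⁻¹ • y := by
    rw [hy, smul_add, smul_smul, inv_mul_cancel₀ ht0.ne']
    module
  have hti : t⁻¹ ≤ 1 := inv_le_one_of_one_le₀ ht
  obtain ⟨g, hgK, hgAB, hgi, hgx⟩ : ∃ g ∈ K, (∀ i, A i ≤ g i ∧ g i ≤ B i) ∧ g i = y i ∧ g ≠ x := by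
    rcases hyi with h | h
    · rw [h]; exact hA i
    · rw [h]; exact hB i
  have hyg : y ≠ g := by
    intro h
    -- If `t = 1`, then `x = y = g`, which is excluded. If `t > 1`, then `x` lies strictly between
    -- `o` and `g`, so it would be interior.
    rcases ht.eq_or_lt with h1 | h1
    · apply hgx
      rw [← h, hy, ← h1]
      simp
    · apply hxK
      rw [hxy, h]
      exact hK.combo_interior_self_mem_interior ho hgK
        (sub_pos.2 (inv_lt_one_of_one_lt₀ h1)) (inv_nonneg.2 ht0.le) (by ring)
  obtain ⟨r, j, hr, hj, hzAB, hzj⟩ := exists_exit_of_box hgAB hyAB hyg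
  set z := g + r • (y - g) with hz
  have hr0 : 0 < r := by linarith
  have hzi : z i = y i := by simp [hz, hgi]
  have hij : i ≠ j := by rintro rfl; exact hj hgi.symm
  obtain ⟨u, hu, hzu⟩ := hU z ⟨hzAB, i, j, hij, by rwa [hzi], hzj⟩
  refine ⟨u, hu, t⁻¹ * r⁻¹, by positivity, ?_⟩
  have hyz : y = (1 - r⁻¹) • g + r⁻¹ • z := by
    rw [hz, smul_add, smul_smul, inv_mul_cancel₀ hr0.ne']
    module
  have h1 : y + r⁻¹ • u ∈ interior K := by
    have : y + r⁻¹ • u = (1 - r⁻¹) • g + r⁻¹ • (z + u) := by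
      rw [smul_add, ← add_assoc, ← hyz]
    rw [this]
    exact hK.combo_self_interior_mem_interior hgK hzu
      (sub_nonneg.2 (inv_le_one_of_one_le₀ hr)) (by positivity) (by ring)
  have h2 : x + (t⁻¹ * r⁻¹) • u = (1 - t⁻¹) • o + t⁻¹ • (y + r⁻¹ • u) := by
    conv_lhs => rw [hxy]
    module
  rw [h2]
  exact hK.combo_self_interior_mem_interior (interior_subset ho) h1
    (sub_nonneg.2 hti) (by positivity) (by ring)

/-- The codimension two skeleton of the box `∏ [0, ℓ i]` can be covered by `N` boxes whose side
lengths add up to less than `1`. -/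
def SkeletonCoverable (ℓ : ι → ℝ) (N : ℕ) : Prop :=
  ∃ S : Finset ((ι → ℝ) × (ι → ℝ)), S.card ≤ N ∧
    (∀ b ∈ S, (∀ i, 0 ≤ b.2 i) ∧ ∑ i, b.2 i < 1) ∧
    ∀ z ∈ codimTwoSkeleton 0 ℓ, ∃ b ∈ S, ∀ i, b.1 i ≤ z i ∧ z i ≤ b.1 i + b.2 i

/-- The affine map from the model box to the given one scales direction `i` by `c i ≤ 1`, so the
side sums of the covering boxes stay below `1`. -/
theorem InUnitCubePosition.exists_directions [DecidableEq ι] {K : Set (ι → ℝ)} (hK : InUnitCubePosition K)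
    {ℓ A B : ι → ℝ} {N : ℕ} (hS : SkeletonCoverable ℓ N) (hAB : ∀ i, A i < B i)
    (hℓ : ∀ i, B i - A i ≤ ℓ i) :
    ∃ U : Finset (ι → ℝ), U.card ≤ N ∧
      ∀ z ∈ codimTwoSkeleton A B, ∃ u ∈ U, z + u ∈ interior K := by
  obtain ⟨S, hcard, hS, hcov⟩ := hS
  let c : ι → ℝ := fun i => (B i - A i) / ℓ i
  have hB : ∀ i, 0 < B i - A i := fun i => sub_pos.2 (hAB i)
  have hℓ0 : ∀ i, 0 < ℓ i := fun i => (hB i).trans_le (hℓ i)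
  have hc0 : ∀ i, 0 < c i := fun i => div_pos (hB i) (hℓ0 i)
  have hc1 : ∀ i, c i ≤ 1 := fun i => (div_le_one (hℓ0 i)).2 (hℓ i)
  have hw : ∀ b : (ι → ℝ) × (ι → ℝ), ∃ w : ι → ℝ, b ∈ S →
      ∀ q : ι → ℝ, (∀ i, 0 ≤ q i ∧ q i ≤ c i * b.2 i) → w + q ∈ interior K := by
    intro b
    by_cases hb : b ∈ S
    · have := hS b hb
      obtain ⟨w, hw⟩ := hK.exists_box_subset_interior (s := fun i => c i * b.2 i)
        (fun i => mul_nonneg (hc0 i).le (this.1 i))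
        ((Finset.sum_le_sum fun i _ => mul_le_of_le_one_left (this.1 i) (hc1 i)).trans_lt this.2)
      exact ⟨w, fun _ => hw⟩
    · exact ⟨0, fun h => absurd h hb⟩
  choose w hw using hw
  refine ⟨S.image fun b => w b - fun i => A i + c i * b.1 i, Finset.card_image_le.trans hcard, ?_⟩
  rintro z ⟨hz, i, j, hij, hzi, hzj⟩
  have hcℓ : ∀ i, c i * ℓ i = B i - A i := fun i => div_mul_cancel₀ _ (hℓ0 i).ne'
  have hend : ∀ i, (z i = A i ∨ z i = B i) →
      ((z i - A i) / c i = (0 : ι → ℝ) i ∨ (z i - A i) / c i = ℓ i) := by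
    rintro i (h | h)
    · left; simp [h]
    · right; rw [h, ← hcℓ, mul_div_cancel_left₀ _ (hc0 i).ne']
  obtain ⟨b, hb, hzb⟩ := hcov (fun i => (z i - A i) / c i)
    ⟨fun i => ⟨div_nonneg (sub_nonneg.2 (hz i).1) (hc0 i).le, by
      rw [div_le_iff₀ (hc0 i), mul_comm, hcℓ]; linarith [(hz i).2]⟩,
      i, j, hij, hend i hzi, hend j hzj⟩
  refine ⟨_, Finset.mem_image_of_mem _ hb, ?_⟩
  have := hw b hb (fun i => z i - (A i + c i * b.1 i)) fun i => by
    have h := hzb i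
    rw [le_div_iff₀ (hc0 i), div_le_iff₀ (hc0 i)] at h
    constructor <;> nlinarith
  convert this using 1
  ext i
  simp; ring

end Boxes

/-! ### Illuminating a body in unit cube position. -/

section Illumination

theorem exists_add_smul_mem_interior {E : Type*} [NormedAddCommGroup E] [NormedSpace ℝ E]
    {K : Set E} {x : E} (hx : x ∈ interior K) (u : E) :
    ∃ μ : ℝ, 0 < μ ∧ x + μ • u ∈ interior K := by
  have hct : Continuous fun t : ℝ => x + t • u := by fun_prop
  have hev : ∀ᶠ t : ℝ in nhds 0, x + t • u ∈ interior K :=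
    hct.continuousAt.eventually_mem (isOpen_interior.mem_nhds (by simpa using hx))
  obtain ⟨t, ht, ht0⟩ := ((hev.filter_mono nhdsWithin_le_nhds).and
    (self_mem_nhdsWithin : Set.Ioi (0 : ℝ) ∈ nhdsWithin 0 (Set.Ioi 0))).exists
  exact ⟨t, ht0, ht⟩

theorem Convex.add_half_smul_mem_interior {E : Type*} [NormedAddCommGroup E] [NormedSpace ℝ E]
    {K : Set E} (hK : Convex ℝ K) {o g : E} (ho : o ∈ interior K) (hg : g ∈ K) :
    g + (1 / 2 : ℝ) • (o - g) ∈ interior K :=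
  hK.add_smul_mem_interior hg (by simpa using ho) ⟨by norm_num, by norm_num⟩

variable {ι : Type*}

theorem codimTwoSkeleton_nonempty [Nontrivial ι] {A B : ι → ℝ} (h : ∀ i, A i ≤ B i) :
    (codimTwoSkeleton A B).Nonempty := by
  obtain ⟨i, j, hij⟩ := exists_pair_ne ι
  exact ⟨A, fun i => ⟨le_rfl, h i⟩, i, j, hij, Or.inl rfl, Or.inl rfl⟩

variable [Fintype ι] [DecidableEq ι]

/-- The points of `K` in a facet of the unit cube. -/
def cubeFacet (K : Set (ι → ℝ)) (f : ι × Bool) : Set (ι → ℝ) :=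
  {x ∈ K | x f.1 = cond f.2 1 0}

namespace InUnitCubePosition

variable {K : Set (ι → ℝ)} (hK : InUnitCubePosition K)
include hK

theorem cubeFacet_nonempty (f : ι × Bool) : (cubeFacet K f).Nonempty := by
  obtain ⟨p, hp, hp'⟩ := hK.exists_segment f.1
  have h0 := hK.subset _ hp f.1
  have h1 := hK.subset _ hp' f.1
  simp only [Pi.add_apply, Pi.single_eq_same] at h1
  rcases f with ⟨i, _ | _⟩
  · exact ⟨p, hp, show p i = 0 by simp only at h0 h1; linarith⟩
  · exact ⟨_, hp', show (p + Pi.single i (1 : ℝ) : ι → ℝ) i = 1 by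
      simp only [Pi.add_apply, Pi.single_eq_same] at h0 h1 ⊢; linarith⟩

theorem pos_and_lt_one_of_mem_interior {o : ι → ℝ} (ho : o ∈ interior K) (i : ι) :
    0 < o i ∧ o i < 1 := by
  obtain ⟨μ, hμ, h⟩ := exists_add_smul_mem_interior ho (1 : ι → ℝ)
  obtain ⟨ν, hν, h'⟩ := exists_add_smul_mem_interior ho (-1 : ι → ℝ)
  have h1 := (hK.subset _ (interior_subset h) i).2
  have h2 := (hK.subset _ (interior_subset h') i).1
  simp only [Pi.add_apply, Pi.smul_apply, Pi.one_apply, Pi.neg_apply, smul_eq_mul] at h1 h2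
  constructor <;> linarith

/-- If every facet of the unit cube contains at least two points of `K`, then the directions
obtained from a covering of the skeleton suffice. -/
theorem exists_illuminates_of_nontrivial [Nontrivial ι] {N : ℕ}
    (hS : SkeletonCoverable (1 : ι → ℝ) N) (hF : ∀ f, (cubeFacet K f).Nontrivial) :
    ∃ U : Finset (ι → ℝ), U.card ≤ N ∧ Illuminates (U : Set (ι → ℝ)) K := by
  obtain ⟨U, hUN, hU⟩ := hK.exists_directions (A := 0) (B := 1) hS (fun i => by simp)
    (fun i => by simp)
  obtain ⟨o, ho⟩ := hK.interior_nonempty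
  refine ⟨U, hUN, fun x hx => ?_⟩
  by_cases hxi : x ∈ interior K
  · obtain ⟨z, hz⟩ := codimTwoSkeleton_nonempty (A := (0 : ι → ℝ)) (B := 1) (fun i => by simp)
    obtain ⟨u, hu, -⟩ := hU z hz
    exact ⟨u, hu, exists_add_smul_mem_interior hxi u⟩
  · refine exists_illuminating_of_skeleton hK.convex ho
      (hK.subset _ (interior_subset ho)) (fun i => ?_) (fun i => ?_) hU (hK.subset x hx) hxi
    · obtain ⟨g, hg, hgx⟩ := (hF (i, false)).exists_ne x
      exact ⟨g, hg.1, hK.subset g hg.1, hg.2, hgx⟩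
    · obtain ⟨g, hg, hgx⟩ := (hF (i, true)).exists_ne x
      exact ⟨g, hg.1, hK.subset g hg.1, hg.2, hgx⟩

theorem exists_illuminates [Nontrivial ι] {N : ℕ} (hS : SkeletonCoverable (1 : ι → ℝ) N) :
    ∃ U : Finset (ι → ℝ), U.card ≤ N + 2 * Fintype.card ι ∧
      Illuminates (U : Set (ι → ℝ)) K := by
  obtain ⟨U, hUN, hU⟩ := hK.exists_directions (A := 0) (B := 1) hS (fun i => by simp)
    (fun i => by simp)
  obtain ⟨o, ho⟩ := hK.interior_nonempty
  choose g hg using hK.cubeFacet_nonempty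
  let D : Finset (ι → ℝ) := Finset.univ.image fun f => o - g f
  have hD : D.card ≤ 2 * Fintype.card ι := by
    refine Finset.card_image_le.trans_eq ?_
    simp [mul_comm]
  refine ⟨U ∪ D, (Finset.card_union_le _ _).trans (by gcongr), fun x hx => ?_⟩
  by_cases hxg : ∃ f, g f = x
  · obtain ⟨f, rfl⟩ := hxg
    exact ⟨o - g f, by simp [D], 1 / 2, by norm_num, hK.convex.add_half_smul_mem_interior ho hx⟩
  push Not at hxg
  by_cases hxi : x ∈ interior K
  · obtain ⟨z, hz⟩ := codimTwoSkeleton_nonempty (A := (0 : ι → ℝ)) (B := 1) (fun i => by simp)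
    obtain ⟨u, hu, -⟩ := hU z hz
    exact ⟨u, by simp [hu], exists_add_smul_mem_interior hxi u⟩
  · obtain ⟨u, hu, h⟩ := exists_illuminating_of_skeleton hK.convex ho
      (hK.subset _ (interior_subset ho))
      (fun i => ⟨g (i, false), (hg _).1, hK.subset _ (hg _).1, (hg (i, false)).2, hxg _⟩)
      (fun i => ⟨g (i, true), (hg _).1, hK.subset _ (hg _).1, (hg (i, true)).2, hxg _⟩)
      hU (hK.subset x hx) hxi
    exact ⟨u, by simp [show u ∈ U from hu], h⟩

/-- The direction from the only point of `K` in a facet to an interior point illuminates all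
points of `K` near the facet. -/
theorem exists_pos_of_subsingleton {o g : ι → ℝ} (ho : o ∈ interior K) {f : ι × Bool}
    (hg : g ∈ cubeFacet K f) (hf : (cubeFacet K f).Subsingleton) :
    ∃ δ : ℝ, 0 < δ ∧ ∀ x ∈ K, |x f.1 - cond f.2 1 0| < δ →
      x + (1 / 2 : ℝ) • (o - g) ∈ interior K := by
  have hW : IsOpen ((fun x => x + (1 / 2 : ℝ) • (o - g)) ⁻¹' interior K) :=
    isOpen_interior.preimage (by fun_prop)
  have hcont : Continuous fun x : ι → ℝ => |x f.1 - cond f.2 1 0| := by fun_prop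
  obtain ⟨δ, hδ, h⟩ := (hK.isCompact.diff hW).exists_forall_le' (a := 0) hcont.continuousOn
    fun x hx => by
      refine abs_pos.2 (sub_ne_zero.2 fun h => hx.2 ?_)
      have : x = g := hf ⟨hx.1, h⟩ hg
      rw [this]
      exact hK.convex.add_half_smul_mem_interior ho hg.1
  refine ⟨δ, hδ, fun x hx hxδ => ?_⟩
  by_contra hx'
  exact (h x ⟨hx, hx'⟩).not_gt hxδ

/-- The midpoint of two points of the facet works: if it lay in another facet of the cube, both
points would lie there too. -/
theorem exists_mem_cubeFacet_avoiding (f : ι × Bool) :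
    ∃ g ∈ cubeFacet K f, ¬(cubeFacet K f).Subsingleton →
      ∀ f', (cubeFacet K f').Subsingleton → g ∉ cubeFacet K f' := by
  by_cases hf : (cubeFacet K f).Subsingleton
  · obtain ⟨g, hg⟩ := hK.cubeFacet_nonempty f
    exact ⟨g, hg, fun h => absurd hf h⟩
  obtain ⟨a, ha, b, hb, hab⟩ := Set.not_subsingleton_iff.1 hf
  have hm : (1 / 2 : ℝ) • a + (1 / 2 : ℝ) • b ∈ K :=
    hK.convex ha.1 hb.1 (by norm_num) (by norm_num) (by norm_num)
  refine ⟨_, ⟨hm, ?_⟩, fun _ f' hf' hm' => hab (hf' ⟨ha.1, ?_⟩ ⟨hb.1, ?_⟩)⟩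
  · have h1 := ha.2
    have h2 := hb.2
    simp only [Pi.add_apply, Pi.smul_apply, smul_eq_mul, h1, h2]
    ring
  all_goals
    have h1 := hm'.2
    have h2 := hK.subset a ha.1 f'.1
    have h3 := hK.subset b hb.1 f'.1
    simp only [Pi.add_apply, Pi.smul_apply, smul_eq_mul] at h1
    cases hb' : f'.2 <;> simp only [hb', cond_true, cond_false] at h1 ⊢ <;> linarith

/-- The direction from a single contact point lights a whole neighbourhood of its facet in `K`. That
facet can be pushed inward, and only the skeleton of a strictly shorter box has to be covered. -/
theorem exists_illuminates_of_subsingleton [Nontrivial ι] {N : ℕ}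
    (hS : ∀ i : ι, ∀ ε : ℝ, 0 < ε → ε ≤ 1 →
      SkeletonCoverable (Function.update (1 : ι → ℝ) i (1 - ε)) N)
    {f₀ : ι × Bool} (hf₀ : (cubeFacet K f₀).Subsingleton) :
    ∃ U : Finset (ι → ℝ), U.card ≤ N + 2 * Fintype.card ι ∧
      Illuminates (U : Set (ι → ℝ)) K := by
  classical
  obtain ⟨o, ho⟩ := hK.interior_nonempty
  have ho01 := hK.pos_and_lt_one_of_mem_interior ho
  choose g hg hg' using hK.exists_mem_cubeFacet_avoiding
  have hev1 : ∀ᶠ ε : ℝ in nhdsWithin 0 (Set.Ioi 0), ∀ f, (cubeFacet K f).Subsingleton →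
      ∀ x ∈ K, |x f.1 - cond f.2 1 0| < ε → x + (1 / 2 : ℝ) • (o - g f) ∈ interior K := by
    refine Filter.eventually_all.2 fun f => ?_
    by_cases hf : (cubeFacet K f).Subsingleton
    · obtain ⟨δ, hδ, h⟩ := hK.exists_pos_of_subsingleton ho (hg f) hf
      filter_upwards [Ioo_mem_nhdsGT hδ] with ε hε _ x hx hxε
      exact h x hx (hxε.trans hε.2)
    · exact Filter.Eventually.of_forall fun _ h => absurd h hf
  have hev2 : ∀ᶠ ε : ℝ in nhdsWithin 0 (Set.Ioi 0), ∀ f f' : ι × Bool,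
      ¬(cubeFacet K f).Subsingleton → (cubeFacet K f').Subsingleton →
        ε ≤ |g f f'.1 - cond f'.2 1 0| := by
    refine Filter.eventually_all.2 fun f => Filter.eventually_all.2 fun f' => ?_
    by_cases h : ¬(cubeFacet K f).Subsingleton ∧ (cubeFacet K f').Subsingleton
    · have hpos : 0 < |g f f'.1 - cond f'.2 1 0| := by
        refine abs_pos.2 (sub_ne_zero.2 fun he => hg' f h.1 f' h.2 ⟨(hg f).1, he⟩)
      filter_upwards [Ioo_mem_nhdsGT hpos] with ε hε _ _
      exact hε.2.le
    · exact Filter.Eventually.of_forall fun _ h1 h2 => absurd ⟨h1, h2⟩ h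
  obtain ⟨ε, ⟨hlight, havoid⟩, hε0, hε1⟩ :=
    ((hev1.and hev2).and (Ioo_mem_nhdsGT (zero_lt_one' ℝ))).exists
  -- Each single-point facet is moved to the hyperplane through `(1 - ε) • g + ε • o`. This interior
  -- point replaces `g` as projection centre and never equals `x`.
  let A : ι → ℝ := fun i => if (cubeFacet K (i, false)).Subsingleton then ε * o i else 0
  let B : ι → ℝ := fun i => if (cubeFacet K (i, true)).Subsingleton then 1 - ε * (1 - o i) else 1
  have hA0 : ∀ i, 0 ≤ A i := fun i => by
    simp only [A]; split_ifs
    · exact mul_nonneg hε0.le (ho01 i).1.le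
    · exact le_rfl
  have hAo : ∀ i, A i ≤ ε * o i := fun i => by
    simp only [A]; split_ifs
    · exact le_rfl
    · exact mul_nonneg hε0.le (ho01 i).1.le
  have hB1 : ∀ i, B i ≤ 1 := fun i => by
    simp only [B]; split_ifs
    · nlinarith [(ho01 i).2]
    · exact le_rfl
  have hBo : ∀ i, 1 - ε * (1 - o i) ≤ B i := fun i => by
    simp only [B]; split_ifs
    · exact le_rfl
    · nlinarith [(ho01 i).2]
  have hAB : ∀ i, A i < B i := fun i => by nlinarith [hAo i, hBo i]
  have hlt : B f₀.1 - A f₀.1 < 1 := by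
    obtain ⟨i, b⟩ := f₀
    have h1 := mul_pos hε0 (ho01 i).1
    have h2 := mul_pos hε0 (sub_pos.2 (ho01 i).2)
    cases b
    · have : A i = ε * o i := if_pos hf₀
      simp only; linarith [hB1 i]
    · have : B i = 1 - ε * (1 - o i) := if_pos hf₀
      simp only; linarith [hA0 i]
  obtain ⟨U, hUN, hU⟩ := hK.exists_directions
    (hS f₀.1 (1 - (B f₀.1 - A f₀.1)) (by linarith) (by linarith [hAB f₀.1])) hAB fun i => by
      rcases eq_or_ne i f₀.1 with rfl | hi
      · simp
      · simp only [ne_eq, hi, not_false_eq_true, Function.update_of_ne, Pi.one_apply]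
        linarith [hA0 i, hB1 i]
  let D : Finset (ι → ℝ) := Finset.univ.image fun f => o - g f
  have hD : D.card ≤ 2 * Fintype.card ι := by
    refine Finset.card_image_le.trans_eq ?_
    simp [mul_comm]
  have hgD : ∀ f, o - g f ∈ ((U ∪ D : Finset (ι → ℝ)) : Set (ι → ℝ)) := fun f => by simp [D]
  refine ⟨U ∪ D, (Finset.card_union_le _ _).trans (by gcongr), fun x hx => ?_⟩
  by_cases hxi : x ∈ interior K
  · exact ⟨_, hgD f₀, exists_add_smul_mem_interior hxi _⟩
  by_cases hxg : ∃ f, g f = x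
  · obtain ⟨f, rfl⟩ := hxg
    exact ⟨_, hgD f, 1 / 2, by norm_num, hK.convex.add_half_smul_mem_interior ho hx⟩
  push Not at hxg
  have hx01 := hK.subset x hx
  by_cases hxA : ∃ i, x i < A i
  · obtain ⟨i, hi⟩ := hxA
    have hf : (cubeFacet K (i, false)).Subsingleton := by
      by_contra hf
      simp only [A, if_neg hf] at hi
      linarith [(hx01 i).1]
    refine ⟨_, hgD (i, false), 1 / 2, by norm_num, hlight _ hf x hx ?_⟩
    simp only [cond_false, sub_zero, abs_of_nonneg (hx01 i).1]
    nlinarith [hAo i, (ho01 i).2]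
  by_cases hxB : ∃ i, B i < x i
  · obtain ⟨i, hi⟩ := hxB
    have hf : (cubeFacet K (i, true)).Subsingleton := by
      by_contra hf
      simp only [B, if_neg hf] at hi
      linarith [(hx01 i).2]
    refine ⟨_, hgD (i, true), 1 / 2, by norm_num, hlight _ hf x hx ?_⟩
    simp only [cond_true, abs_sub_comm (x i), abs_of_nonneg (sub_nonneg.2 (hx01 i).2)]
    nlinarith [hBo i, (ho01 i).1]
  push Not at hxA hxB
  have hgAB : ∀ f, ¬(cubeFacet K f).Subsingleton → ∀ i, A i ≤ g f i ∧ g f i ≤ B i := by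
    intro f hf i
    have h01 := hK.subset _ (hg f).1 i
    constructor
    · by_cases h : (cubeFacet K (i, false)).Subsingleton
      · have := havoid f (i, false) hf h
        simp only [cond_false, sub_zero, abs_of_nonneg h01.1] at this
        nlinarith [hAo i, (ho01 i).2]
      · simpa only [A, if_neg h] using h01.1
    · by_cases h : (cubeFacet K (i, true)).Subsingleton
      · have := havoid f (i, true) hf h
        simp only [cond_true, abs_sub_comm (g f i), abs_of_nonneg (sub_nonneg.2 h01.2)] at this
        nlinarith [hBo i, (ho01 i).1]
      · simpa only [B, if_neg h] using h01.2
  have hmid : ∀ f, ((1 - ε) • g f + ε • o) ∈ interior K := fun f =>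
    hK.convex.combo_self_interior_mem_interior (hg f).1 ho (by linarith) hε0 (by ring)
  have hmidAB : ∀ f i, A i ≤ ((1 - ε) • g f + ε • o) i ∧ ((1 - ε) • g f + ε • o) i ≤ B i := by
    intro f i
    have h01 := hK.subset _ (hg f).1 i
    simp only [Pi.add_apply, Pi.smul_apply, smul_eq_mul]
    constructor
    · nlinarith [hAo i, mul_nonneg (sub_nonneg.2 hε1.le) h01.1]
    · nlinarith [hBo i, mul_nonneg (sub_nonneg.2 hε1.le) (sub_nonneg.2 h01.2)]
  have hmidx : ∀ f, (1 - ε) • g f + ε • o ≠ x := fun f h => hxi (h ▸ hmid f)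
  obtain ⟨u, hu, h⟩ := exists_illuminating_of_skeleton (A := A) (B := B) (x := x) hK.convex ho
    (fun i => ⟨by nlinarith [hAo i, (ho01 i).1], by nlinarith [hBo i, (ho01 i).2]⟩)
    (fun i => by
      by_cases h : (cubeFacet K (i, false)).Subsingleton
      · refine ⟨_, interior_subset (hmid (i, false)), hmidAB _, ?_, hmidx _⟩
        have h1 : g (i, false) i = 0 := (hg (i, false)).2
        simp [A, h, h1]
      · refine ⟨_, (hg (i, false)).1, hgAB _ h, ?_, hxg _⟩
        have h1 : g (i, false) i = 0 := (hg (i, false)).2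
        simp [A, h, h1])
    (fun i => by
      by_cases h : (cubeFacet K (i, true)).Subsingleton
      · refine ⟨_, interior_subset (hmid (i, true)), hmidAB _, ?_, hmidx _⟩
        have h1 : g (i, true) i = 1 := (hg (i, true)).2
        simp only [Pi.add_apply, Pi.smul_apply, smul_eq_mul, h1, B, if_pos h]
        ring
      · refine ⟨_, (hg (i, true)).1, hgAB _ h, ?_, hxg _⟩
        have h1 : g (i, true) i = 1 := (hg (i, true)).2
        simp [B, h, h1])
    hU (fun i => ⟨hxA i, hxB i⟩) hxi
  exact ⟨u, by simp [show u ∈ U from hu], h⟩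

end InUnitCubePosition

end Illumination

/-! ### Layered coverings of the skeleton. -/

section Layers

theorem exists_cell {w t : ℝ} {m : ℕ} (hm : 0 < m) (h0 : 0 ≤ t) (ht : t ≤ m * w) :
    ∃ k < m, k * w ≤ t ∧ t ≤ k * w + w := by
  induction m with
  | zero => exact absurd hm (lt_irrefl _)
  | succ m ih =>
    rcases le_or_gt ((m : ℝ) * w) t with h | h
    · exact ⟨m, Nat.lt_succ_self m, h, by push_cast at ht; linarith⟩
    · rcases Nat.eq_zero_or_pos m with rfl | hm'
      · simp only [Nat.cast_zero, zero_mul] at h; linarith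
      · obtain ⟨k, hk, h⟩ := ih hm' h.le
        exact ⟨k, hk.trans (Nat.lt_succ_self m), h⟩

theorem SkeletonCoverable.mono {ι : Type*} [Fintype ι] {ℓ : ι → ℝ} {M N : ℕ}
    (h : SkeletonCoverable ℓ M) (hMN : M ≤ N) : SkeletonCoverable ℓ N := by
  obtain ⟨S, hS, h⟩ := h
  exact ⟨S, hS.trans hMN, h⟩

variable {ι : Type*} [Fintype ι] [DecidableEq ι]

/-- Numbers describing a covering of the codimension two skeleton of the box `∏ [0, ℓ i]`: the boxes
along a face with directions `L` have width `a L j` in the directions `j ∉ L`, and the part of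
the face not covered by the boxes along smaller faces is cut into `m L i` pieces in the
direction `i ∈ L`. -/
structure IsLayering {𝕜 : Type*} [Field 𝕜] [LinearOrder 𝕜] (ℓ : ι → 𝕜) (a : Finset ι → ι → 𝕜)
    (m : Finset ι → ι → ℕ) : Prop where
  nonneg : ∀ L : Finset ι, L.card + 2 ≤ Fintype.card ι → ∀ j ∉ L, 0 ≤ a L j
  anti : ∀ L : Finset ι, L.card + 2 ≤ Fintype.card ι → ∀ i ∈ L, ∀ j ∉ L, a L j ≤ a (L.erase i) j
  le_length : ∀ L : Finset ι, L.card + 2 ≤ Fintype.card ι → ∀ i ∈ L, 2 * a (L.erase i) i ≤ ℓ i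
  pos : ∀ L : Finset ι, L.card + 2 ≤ Fintype.card ι → ∀ i ∈ L, 0 < m L i

/-- The sides of the boxes of a layering along a face with directions `L`. -/
def layerSide {𝕜 : Type*} [Field 𝕜] (ℓ : ι → 𝕜) (a : Finset ι → ι → 𝕜)
    (m : Finset ι → ι → ℕ) (L : Finset ι) (i : ι) : 𝕜 :=
  if i ∈ L then (ℓ i - 2 * a (L.erase i) i) / m L i else a L i

/-- The number of boxes in a layering. -/
def layerCount (m : Finset ι → ι → ℕ) : ℕ :=
  ∑ L : Finset ι with L.card + 2 ≤ Fintype.card ι, ∏ i, if i ∈ L then m L i else 2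

/-- For a skeleton point take a smallest `L` such that the point is within `a L j` of the boundary
in each direction `j ∉ L`. By minimality and `anti`, it is at least `a (L.erase i) i` from the
boundary in each direction `i ∈ L`, so it lies in the part cut into pieces. -/
theorem IsLayering.skeletonCoverable {ℓ : ι → ℝ} {a : Finset ι → ι → ℝ}
    {m : Finset ι → ι → ℕ} (h : IsLayering ℓ a m)
    (hsum : ∀ L : Finset ι, L.card + 2 ≤ Fintype.card ι → ∑ i, layerSide ℓ a m L i < 1) :
    SkeletonCoverable ℓ (layerCount m) := by
  let corner : Finset ι → (ι → ℕ) → ι → ℝ := fun L f i =>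
    if i ∈ L then a (L.erase i) i + f i * layerSide ℓ a m L i
    else if f i = 0 then 0 else ℓ i - a L i
  let S : Finset ((ι → ℝ) × (ι → ℝ)) :=
    ({L : Finset ι | L.card + 2 ≤ Fintype.card ι} : Finset (Finset ι)).biUnion fun L =>
      (Fintype.piFinset fun i => Finset.range (if i ∈ L then m L i else 2)).image
        fun f => (corner L f, layerSide ℓ a m L)
  refine ⟨S, ?_, ?_, ?_⟩
  · refine Finset.card_biUnion_le.trans (Finset.sum_le_sum fun L _ => ?_)
    refine Finset.card_image_le.trans_eq ?_
    simp [Fintype.card_piFinset]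
  · intro b hb
    simp only [S, Finset.mem_biUnion, Finset.mem_filter, Finset.mem_univ, true_and,
      Finset.mem_image] at hb
    obtain ⟨L, hL, f, -, rfl⟩ := hb
    refine ⟨fun i => ?_, hsum L hL⟩
    simp only [layerSide]
    split_ifs with hi
    · exact div_nonneg (sub_nonneg.2 (h.le_length L hL i hi)) (Nat.cast_nonneg _)
    · exact h.nonneg L hL i hi
  · rintro z ⟨hz, i₁, i₂, hne, hz₁, hz₂⟩
    let d : ι → ℝ := fun i => min (z i) (ℓ i - z i)
    have hd : ∀ i, (z i = (0 : ι → ℝ) i ∨ z i = ℓ i) → d i ≤ 0 := by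
      rintro i (hi | hi)
      · exact (min_le_left _ _).trans_eq hi
      · exact (min_le_right _ _).trans_eq (by rw [hi, sub_self])
    let C : Finset (Finset ι) :=
      {L | L.card + 2 ≤ Fintype.card ι ∧ ∀ j ∉ L, d j ≤ a L j}
    have hC : C.Nonempty := by
      have hcard : ((Finset.univ.erase i₁).erase i₂).card + 2 = Fintype.card ι := by
        have h1 := Finset.card_erase_add_one
          (show i₂ ∈ Finset.univ.erase i₁ by simp [hne.symm])
        have h2 := Finset.card_erase_add_one (Finset.mem_univ i₁)
        rw [Finset.card_univ] at h2
        omega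
      refine ⟨(Finset.univ.erase i₁).erase i₂, ?_⟩
      simp only [C, Finset.mem_filter, Finset.mem_univ, true_and]
      refine ⟨hcard.le, fun j hj => ?_⟩
      refine le_trans ?_ (h.nonneg _ hcard.le j hj)
      have : j = i₁ ∨ j = i₂ := by
        simp only [Finset.mem_erase, Finset.mem_univ, and_true] at hj
        tauto
      rcases this with rfl | rfl
      · exact hd _ hz₁
      · exact hd _ hz₂
    obtain ⟨L, hL, hmin⟩ := C.exists_min_image Finset.card hC
    simp only [C, Finset.mem_filter, Finset.mem_univ, true_and] at hL hmin
    obtain ⟨hcard, hout⟩ := hL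
    have hin : ∀ i ∈ L, a (L.erase i) i ≤ d i := by
      intro i hi
      by_contra hlt
      have hlt' := Finset.card_erase_lt_of_mem hi
      refine (hmin (L.erase i) ⟨by omega, fun j hj => ?_⟩).not_gt hlt'
      rcases eq_or_ne j i with rfl | hji
      · exact (not_le.1 hlt).le
      · have hjL : j ∉ L := fun hjL => hj (Finset.mem_erase.2 ⟨hji, hjL⟩)
        exact (hout j hjL).trans (h.anti L hcard i hi j hjL)
    have hf : ∀ i, ∃ k : ℕ, k < (if i ∈ L then m L i else 2) ∧
        ∀ f : ι → ℕ, f i = k → corner L f i ≤ z i ∧ z i ≤ corner L f i + layerSide ℓ a m L i := by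
      intro i
      by_cases hi : i ∈ L
      · have hd := hin i hi
        have hpos : (0 : ℝ) < m L i := Nat.cast_pos.2 (h.pos L hcard i hi)
        have h1 : a (L.erase i) i ≤ z i := hd.trans (min_le_left _ _)
        have h2 : a (L.erase i) i ≤ ℓ i - z i := hd.trans (min_le_right _ _)
        obtain ⟨k, hk, hk1, hk2⟩ := exists_cell (w := layerSide ℓ a m L i)
          (t := z i - a (L.erase i) i) (h.pos L hcard i hi) (by linarith) (by
            rw [layerSide, if_pos hi, mul_div_cancel₀ _ hpos.ne']
            linarith)
        refine ⟨k, by rwa [if_pos hi], fun f hf => ?_⟩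
        simp only [corner, if_pos hi, hf]
        constructor <;> linarith
      · simp only [corner, layerSide, if_neg hi]
        rcases min_le_iff.1 (hout i hi) with hzi | hzi
        · refine ⟨0, by norm_num, fun f hf => ?_⟩
          simp only [hf, if_true]
          exact ⟨(hz i).1, by linarith⟩
        · refine ⟨1, by norm_num, fun f hf => ?_⟩
          simp only [hf, one_ne_zero, if_false]
          exact ⟨by linarith, by linarith [(hz i).2]⟩
    choose f hf hcov using hf
    refine ⟨(corner L f, layerSide ℓ a m L), ?_, fun i => hcov i f rfl⟩
    simp only [S, Finset.mem_biUnion, Finset.mem_filter, Finset.mem_univ, true_and,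
      Finset.mem_image]
    exact ⟨L, hcard, f, Fintype.mem_piFinset.2 fun i => Finset.mem_range.2 (hf i), rfl⟩

/-- Layerings of two boxes can be interpolated. -/
theorem IsLayering.skeletonCoverable_interpolate {ℓ₀ ℓ₁ : ι → ℚ} {a₀ a₁ : Finset ι → ι → ℚ}
    {m : Finset ι → ι → ℕ} (h₀ : IsLayering ℓ₀ a₀ m) (h₁ : IsLayering ℓ₁ a₁ m)
    (hsum₀ : ∀ L : Finset ι, L.card + 2 ≤ Fintype.card ι → ∑ i, layerSide ℓ₀ a₀ m L i ≤ 1)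
    (hsum₁ : ∀ L : Finset ι, L.card + 2 ≤ Fintype.card ι → ∑ i, layerSide ℓ₁ a₁ m L i < 1)
    {ε : ℝ} (hε : 0 < ε) (hε1 : ε ≤ 1) :
    SkeletonCoverable (fun i => (1 - ε) * ℓ₀ i + ε * ℓ₁ i) (layerCount m) := by
  have hε' : 0 ≤ 1 - ε := sub_nonneg.2 hε1
  have hcomb : ∀ {p q r s : ℚ}, p ≤ q → r ≤ s →
      (1 - ε) * (p : ℝ) + ε * (r : ℝ) ≤ (1 - ε) * (q : ℝ) + ε * (s : ℝ) := by
    intro p q r s hpq hrs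
    have h1 : (p : ℝ) ≤ q := by exact_mod_cast hpq
    have h2 : (r : ℝ) ≤ s := by exact_mod_cast hrs
    gcongr
  refine IsLayering.skeletonCoverable (a := fun L i => (1 - ε) * a₀ L i + ε * a₁ L i)
    ⟨fun L hL j hj => ?_, fun L hL i hi j hj => ?_, fun L hL i hi => ?_, h₀.pos⟩ fun L hL => ?_
  · simpa using hcomb (h₀.nonneg L hL j hj) (h₁.nonneg L hL j hj)
  · exact hcomb (h₀.anti L hL i hi j hj) (h₁.anti L hL i hi j hj)
  · have := hcomb (h₀.le_length L hL i hi) (h₁.le_length L hL i hi)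
    push_cast at this
    linarith
  · have hside : ∀ i, layerSide (fun i => (1 - ε) * (ℓ₀ i : ℝ) + ε * ℓ₁ i)
        (fun L i => (1 - ε) * (a₀ L i : ℝ) + ε * a₁ L i) m L i =
        -- For fixed `m` the sides are linear in lengths and widths jointly, so strictness at one
        -- end suffices when `ε > 0`.
        (1 - ε) * ((layerSide ℓ₀ a₀ m L i : ℚ) : ℝ) + ε * ((layerSide ℓ₁ a₁ m L i : ℚ) : ℝ) := by
      intro i
      simp only [layerSide]
      split_ifs
      · push_cast; ring
      · rfl
    have h1 : ((∑ i, layerSide ℓ₀ a₀ m L i : ℚ) : ℝ) ≤ 1 := by exact_mod_cast hsum₀ L hL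
    have h2 : ((∑ i, layerSide ℓ₁ a₁ m L i : ℚ) : ℝ) < 1 := by exact_mod_cast hsum₁ L hL
    simp only [hside, Finset.sum_add_distrib, ← Finset.mul_sum]
    push_cast at h1 h2
    nlinarith

theorem IsLayering.skeletonCoverable_one {a : Finset ι → ι → ℚ} {m : Finset ι → ι → ℕ}
    (h : IsLayering (1 : ι → ℚ) a m)
    (hsum : ∀ L : Finset ι, L.card + 2 ≤ Fintype.card ι → ∑ i, layerSide (1 : ι → ℚ) a m L i < 1) :
    SkeletonCoverable (1 : ι → ℝ) (layerCount m) := by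
  have := h.skeletonCoverable_interpolate h (fun L hL => (hsum L hL).le) hsum one_pos le_rfl
  rw [show (1 : ι → ℝ) = fun _ => 1 from rfl]
  simpa using this

end Layers

/-! ### Explicit coverings in dimensions four to six. -/

section Coverings

/-- For `L.card = 0, ..., 4` the counts are 64 + 768 + 3840 + 5760 + 4860. With three pieces in
every direction the case `L.card = 3` would have side sum 1.055; a fourth piece in the largest
direction brings it below `1`. -/
theorem skeletonCoverable_six : SkeletonCoverable (1 : Fin 6 → ℝ) 15292 := by
  refine SkeletonCoverable.mono (IsLayering.skeletonCoverable_one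
    (a := fun L _ => if L.card ≤ 2 then 166 / 1000 else if L.card = 3 then 129 / 1000 else 0)
    (m := fun L i => if L.card ≤ 2 then 4 else
      if L.card = 3 ∧ ∀ j ∈ L, j ≤ i then 4 else 3) ⟨?_, ?_, ?_, ?_⟩ ?_) ?_
  all_goals decide +kernel

/-- The counts are 32 + 240 + 320 + 480; again one extra piece in the largest direction suffices
when `L.card = 3`. -/
theorem skeletonCoverable_five : SkeletonCoverable (1 : Fin 5 → ℝ) 1072 := by
  refine SkeletonCoverable.mono (IsLayering.skeletonCoverable_one
    (a := fun L _ => if L.card ≤ 1 then 199 / 1000 else if L.card = 2 then 132 / 1000 else 0)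
    (m := fun L i => if L.card = 1 then 3 else
      if L.card = 3 ∧ ∀ j ∈ L, j ≤ i then 3 else 2) ⟨?_, ?_, ?_, ?_⟩ ?_) ?_
  all_goals decide +kernel

/-- The condition `j = i + 1 ∨ j = i + 2 ∧ i < 2` orients every pair of directions exactly once, and
each two-dimensional face is halved in the tail direction. The directions 0 and 1 have two
successors instead of one, hence the larger width `27 / 100`. The counts are 16 + 32 + 48. -/
theorem skeletonCoverable_four : SkeletonCoverable (1 : Fin 4 → ℝ) 96 := by
  refine SkeletonCoverable.mono (IsLayering.skeletonCoverable_one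
    (a := fun L j => if L.card = 0 then (if j < 2 then 27 / 100 else 22 / 100) else
      if L.card = 1 then
        ∑ i ∈ L, if j = i + 1 ∨ j = i + 2 ∧ i < 2 then 21 / 100 else 1 / 10
      else 0)
    (m := fun L i => if ∃ j ∈ L, j = i + 1 ∨ j = i + 2 ∧ i < 2 then 2 else 1)
    ⟨?_, ?_, ?_, ?_⟩ ?_) ?_
  all_goals decide +kernel

/-- The width of the boxes of a covering of the codimension two skeleton of the unit cube by boxes
whose side lengths add up to `1`. -/
def tightWidth (L : Finset (Fin 4)) (j : Fin 4) : ℚ :=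
  if L.card = 0 then 1 / 4 else if L.card = 1 ∧ j - 1 ∉ L then 1 / 4 else 0

/-- The width of the boxes in the limit case in which the length of the cube in the direction `k`
is zero. -/
def shrunkWidth (k : Fin 4) (L : Finset (Fin 4)) (j : Fin 4) : ℚ :=
  if j = k then 0
  else if L.card = 0 then 5 / 16
  else if L.card = 1 ∧ j - 1 ∉ L then
    if (j = k + 3 ∧ k + 1 ∈ L) ∨ k ∈ L then 1 / 4 else 3 / 10
  else 0

/-- Only faces with cyclically adjacent directions are halved, giving 16 + 32 + 40 boxes. For the
full cube some side sums equal `1`; interpolating with a strict layering of the box flattened in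
direction `k` creates the slack. -/
theorem skeletonCoverable_four_of_shrunk (k : Fin 4) {ε : ℝ} (hε : 0 < ε) (hε1 : ε ≤ 1) :
    SkeletonCoverable (Function.update (1 : Fin 4 → ℝ) k (1 - ε)) 88 := by
  have key : SkeletonCoverable
      (fun i => (1 - ε) * ((1 : Fin 4 → ℚ) i : ℝ) + ε * ((if i = k then 0 else 1 : ℚ) : ℝ))
      (layerCount fun (L : Finset (Fin 4)) (i : Fin 4) => if i - 1 ∈ L then 2 else 1) := by
    refine IsLayering.skeletonCoverable_interpolate (a₀ := tightWidth) (a₁ := shrunkWidth k)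
      ⟨?_, ?_, ?_, ?_⟩ ⟨?_, ?_, ?_, ?_⟩ ?_ ?_ hε hε1
    all_goals revert k; decide +kernel
  have hlength : Function.update (1 : Fin 4 → ℝ) k (1 - ε) =
      fun i => (1 - ε) * ((1 : Fin 4 → ℚ) i : ℝ) + ε * ((if i = k then 0 else 1 : ℚ) : ℝ) := by
    ext i
    rcases eq_or_ne i k with rfl | h <;> simp [*]
  rw [hlength]
  exact key.mono (by decide +kernel)

end Coverings

/-! ### Assembling the bounds. -/

theorem translativeCoveringNumber_le_of_inUnitCubePosition {n N : ℕ}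
    (h : ∀ K : Set (Fin n → ℝ), InUnitCubePosition K →
      ∃ U : Finset (Fin n → ℝ), U.card ≤ N ∧ Illuminates (U : Set (Fin n → ℝ)) K) :
    hadwigerCoveringNumber n ≤ N := by
  classical
  refine iSup₂_le fun K hK => ?_
  obtain ⟨A, c, hA⟩ := exists_inUnitCubePosition (EuclideanSpace.equiv (Fin n) ℝ)
    K.isCompact K.convex hK
  obtain ⟨U, hUN, hU⟩ := h _ hA
  have := Illuminates.of_affine_image A c hU
  rw [← Finset.coe_image] at this
  refine (translativeCoveringNumber_le_card K.isCompact K.convex _ this).trans ?_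
  exact_mod_cast Finset.card_image_le.trans hUN

theorem mainTheorem1 :
    hadwigerCoveringNumber 4 ≤ 96 ∧ hadwigerCoveringNumber 5 ≤ 1091 ∧
      hadwigerCoveringNumber 6 ≤ 15373 := by
  refine ⟨?_, ?_, ?_⟩
  · refine translativeCoveringNumber_le_of_inUnitCubePosition (N := 96) fun K hK => ?_
    by_cases hF : ∃ f, (cubeFacet K f).Subsingleton
    · obtain ⟨f, hf⟩ := hF
      exact hK.exists_illuminates_of_subsingleton
        (fun i ε hε hε1 => skeletonCoverable_four_of_shrunk i hε hε1) hf
    · push Not at hF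
      exact hK.exists_illuminates_of_nontrivial skeletonCoverable_four
        fun f => by simpa using hF f
  · refine translativeCoveringNumber_le_of_inUnitCubePosition (N := 1091) fun K hK => ?_
    obtain ⟨U, hUN, hU⟩ := hK.exists_illuminates skeletonCoverable_five
    -- The count is 1072 + 10 = 1082, with room to spare; in dimension six it is 15292 + 12 = 15304.
    exact ⟨U, hUN.trans (by simp), hU⟩
  · refine translativeCoveringNumber_le_of_inUnitCubePosition (N := 15373) fun K hK => ?_
    obtain ⟨U, hUN, hU⟩ := hK.exists_illuminates skeletonCoverable_six
    exact ⟨U, hUN.trans (by simp), hU⟩
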